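/- **Setting.** Let $\mathcal T$ be a set of records and $\mathcal D=\mathcal T^*$ the set of datasets; $|D|$ is the number of records of $D$. Two datasets are *neighbors* if they have the same size and differ in exactly one position, or if one is a copy of the other with one extra record. A *mechanism family* $\mathcal M=(\mathcal M_\kappa)_{\kappa\in\mathbb N}$ assigns to every $\kappa$ and every dataset $D$ a probability distribution $\mathcal M_\kappa(D)$ on $\{0,1\}^*$. A family $A=(A_\kappa)_\kappa$ of probabilistic functions $\{0,1\}^*\to\{0,1\}^*$ is *non-uniform PPT* if one probabilistic Turing machine with fair coins, given $1^\kappa$, an advice that depends only on $\kappa$ and has length polynomial in $\kappa$, and $x$, always halts in time polynomial in $\kappa+|x|$ and outputs a string distributed as $A_\kappa(x)$ (uniform PPT functions are the case of empty advice). A function $\mathsf{neg}:\mathbb N\to\mathbb R$ is *negligible* if $\kappa^n\,\mathsf{neg}(\kappa)\to0$ for every $n$. Distributions $\mu,\nu$ are $\varepsilon$-indistinguishable, $\mu\approx_\varepsilon\nu$, if $\mu(S)\le e^{\varepsilon}\nu(S)$ and $\nu(S)\le e^{\varepsilon}\mu(S)$ for all $S$; a mechanism $\mathcal M_\kappa$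 is $\varepsilon$-DP if $\mathcal M_\kappa(D_1)\approx_\varepsilon\mathcal M_\kappa(D_2)$ for all neighbors $D_1,D_2$. Let $(\varepsilon_\kappa)_{\kappa\in\mathbb N}$ be a sequence of real numbers. * $\mathcal M$ is *$\varepsilon_\kappa$-IndCDP* if there is a negligible $\mathsf{neg}$ such that for all non-uniform PPT $\Omega$, all polynomials $p$, all sufficiently large $\kappa$ and all neighbors $D_1,D_2$ of size at most $p(\kappa)$, $$\Pr[\Omega_\kappa(\mathcal M_\kappa(D_1))=1]\le e^{\varepsilon_\kappa}\Pr[\Omega_\kappa(\mathcal M_\kappa(D_2))=1]+\mathsf{neg}(\kappa).$$ * $\mathcal M$ is *$\varepsilon_\kappa$-SimCDP* if there are a family $(\mathcal M'_\kappa)_\kappa$ with each $\mathcal M'_\kappa$ $\varepsilon_\kappa$-DP and a negligible $\mathsf{neg}$ such that for all non-uniform PPT $\Omega$, all polynomials $p$, all sufficiently large $\kappa$ and all $D$ of size at most $p(\kappa)$, $$\Pr[\Omega_\kappa(\mathcal M_\kappa(D))=1]-\Pr[\Omega_\kappa(\mathcal M'_\kappa(D))=1]\le\mathsf{neg}(\kappa).$$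 * Let $\mathsf{Agg}$ be a class of families $\mathsf{agg}=(\mathsf{agg}_\kappa)_\kappa$ of (possibly randomized) maps $\mathcal D\to\{0,1\}^*$. $\mathcal M$ is *$(\mathsf{Agg},\varepsilon_\kappa)$-computational zero-knowledge private* if there are $\mathsf{agg}\in\mathsf{Agg}$, a non-uniform PPT simulator $\mathsf{Sim}$ and a negligible $\mathsf{neg}$ such that for all non-uniform PPT $\Omega$, all polynomials $p$, all sufficiently large $\kappa$ and all neighbors $D_1,D_2$ of size at most $p(\kappa)$, the numbers $a=\Pr[\Omega_\kappa(\mathcal M_\kappa(D_1))=1]$ and $b=\Pr[\Omega_\kappa(\mathsf{Sim}_\kappa(\mathsf{agg}_\kappa(D_2)))=1]$ satisfy $a\le e^{\varepsilon_\kappa}b+\mathsf{neg}(\kappa)$ and $b\le e^{\varepsilon_\kappa}a+\mathsf{neg}(\kappa)$. A privacy definition satisfies *convexity* if, whenever $\mathcal M^1$ and $\mathcal M^2$ satisfy it and $p\in[0,1]$, the family that runs $\mathcal M^1_\kappa(D)$ with probability $p$ and $\mathcal M^2_\kappa(D)$ with probability $1-p$ satisfies it. It satisfies *PPT post-processing*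 if, whenever $\mathcal M$ satisfies it and $f$ is non-uniform PPT, the family $D\mapsto f_\kappa(\mathcal M_\kappa(D))$ satisfies it. **Proposition.** (1) $\varepsilon_\kappa$-IndCDP satisfies convexity and PPT post-processing. (2) $\varepsilon_\kappa$-SimCDP satisfies convexity and PPT post-processing. (3) For every $\mathsf{Agg}$, $(\mathsf{Agg},\varepsilon_\kappa)$-computational zero-knowledge privacy satisfies PPT post-processing. It satisfies convexity for every $\mathsf{Agg}$ that is directed in the following sense (for instance, for a single fixed aggregate, $\mathsf{Agg}=\{\mathsf{agg}\}$): for all $\mathsf{agg}^1,\mathsf{agg}^2\in\mathsf{Agg}$ there are $\mathsf{agg}\in\mathsf{Agg}$ and non-uniform PPT $g^1,g^2$ such that $g^i_\kappa(\mathsf{agg}_\kappa(D))$ has the same distribution as $\mathsf{agg}^i_\kappa(D)$ for $i=1,2$ and all $\kappa$, $D$. -/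

import Mathlib

namespace CompDP

open scoped ENNReal

/-- Finite bit strings: outputs of mechanisms, inputs and outputs of machines. -/
abbrev Str : Type := List Bool

/-! ### Probabilistic polynomial-time Turing machines -/

/-- A probabilistic Turing machine, in Mathlib's multi-stack presentation `Turing.TM2` of Turing
machines, with binary stacks. As usual it has two transition functions `prog false` and
`prog true`; at every step a fresh fair coin decides which one is applied. -/
structure ProbTM where
  /-- index type of the stacks -/
  K : Type
  [decK : DecidableEq K]
  [finK : Fintype K]
  /-- labels -/
  Lab : Type
  [finLab : Fintype Lab]
  /-- internal states -/
  St : Type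
  [finSt : Fintype St]
  /-- the label at which the computation starts -/
  start : Lab
  /-- the initial internal state -/
  init : St
  /-- the stack that initially holds the security parameter in unary -/
  secStack : K
  /-- the stack that initially holds the input -/
  inStack : K
  sec_ne_in : secStack ≠ inStack
  /-- the stack from which the output is read after halting -/
  outStack : K
  /-- the two transition functions -/
  prog : Bool → Lab → Turing.TM2.Stmt (fun _ : K => Bool) Lab St

attribute [instance] ProbTM.decK ProbTM.finK ProbTM.finLab ProbTM.finSt

namespace ProbTM

/-- Configurations: label (`none` when halted), internal state and stacks. -/
abbrev Cfg (M : ProbTM) : Type := Turing.TM2.Cfg (fun _ : M.K => Bool) M.Lab M.St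

/-- The initial configuration for security parameter `κ`, advice `z` and input `x`. The advice is a
tuple of strings, one for each stack that does not hold the input or the security parameter; a
machine without advice is the case where all of them are empty. -/
def initCfg (M : ProbTM) (κ : ℕ) (z : M.K → Str) (x : Str) : M.Cfg where
  l := some M.start
  var := M.init
  stk := fun k =>
    if k = M.inStack then x
    else if k = M.secStack then List.replicate κ true
    else z k

/-- One step: toss a fair coin and apply the corresponding transition function. A halted
configuration stays as it is. -/
noncomputable def step (M : ProbTM) (c : M.Cfg) : PMF M.Cfg :=
  match c.l with
  | none => PMF.pure c
  | some l => (PMF.uniformOfFintype Bool).map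
      fun b => Turing.TM2.stepAux (M.prog b l) c.var c.stk

/-- The distribution of the configuration after `t` steps. -/
noncomputable def run (M : ProbTM) : ℕ → M.Cfg → PMF M.Cfg
  | 0, c => PMF.pure c
  | t + 1, c => (M.step c).bind (M.run t)

/-- Started with security parameter `κ`, advice `z` and input `x`, the machine halts within `t`
steps whatever the coins are, and its output has distribution `μ`. -/
def OutputsWithin (M : ProbTM) (κ : ℕ) (z : M.K → Str) (x : Str) (t : ℕ) (μ : PMF Str) : Prop :=
  (∀ c ∈ (M.run t (M.initCfg κ z x)).support, c.l = none) ∧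
    (M.run t (M.initCfg κ z x)).map (fun c => c.stk M.outStack) = μ

end ProbTM

/-- The family `A κ` of probabilistic functions on bit strings is computable by a non-uniform
probabilistic polynomial-time Turing machine: a single machine gets `1^κ`, an advice depending only
on `κ` and of length polynomial in `κ`, and the input `x`; it halts in time polynomial in
`κ + |x|`, with output distributed as `A κ x`. -/
def IsNonuniformPPT (A : ℕ → Str → PMF Str) : Prop :=
  ∃ (M : ProbTM) (z : ℕ → M.K → Str) (a t : Polynomial ℕ),
    (∀ κ k, (z κ k).length ≤ a.eval κ) ∧
    ∀ κ x, M.OutputsWithin κ (z κ) x (t.eval (κ + x.length)) (A κ x)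

/-! ### Mechanisms -/

section
variable {T : Type*}

/-- A family of privacy mechanisms indexed by the security parameter: for each `κ`, a dataset
(a finite sequence of records) is mapped to a distribution over bit strings. -/
abbrev Mech (T : Type*) : Type _ := ℕ → List T → PMF Str

/-- The datasets differ only in one record: either they have the same size and differ in exactly
one position, or one is a copy of the other with one extra record. -/
def Neighbor (D₁ D₂ : List T) : Prop :=
  (∃ l r t t', t ≠ t' ∧ D₁ = l ++ t :: r ∧ D₂ = l ++ t' :: r) ∨
  (∃ l r t, D₁ = l ++ t :: r ∧ D₂ = l ++ r) ∨
  (∃ l r t, D₂ = l ++ t :: r ∧ D₁ = l ++ r)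

/-- `ε`-indistinguishability of two distributions. -/
def Indist (ε : ℝ) (μ ν : PMF Str) : Prop :=
  ∀ S : Set Str,
    μ.toOuterMeasure S ≤ ENNReal.ofReal (Real.exp ε) * ν.toOuterMeasure S ∧
    ν.toOuterMeasure S ≤ ENNReal.ofReal (Real.exp ε) * μ.toOuterMeasure S

/-- `ε`-differential privacy of a single mechanism. -/
def IsDP (ε : ℝ) (M : List T → PMF Str) : Prop :=
  ∀ D₁ D₂, Neighbor D₁ D₂ → Indist ε (M D₁) (M D₂)

/-- The probability that the probabilistic algorithm `A` outputs `1` on a sample of `μ`. -/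
noncomputable def prOne (A : Str → PMF Str) (μ : PMF Str) : ℝ :=
  ((μ.bind A) [true]).toReal

/-- Negligible functions: they converge to zero faster than the inverse of any polynomial. -/
def Negligible (neg : ℕ → ℝ) : Prop :=
  Asymptotics.SuperpolynomialDecay Filter.atTop (fun κ : ℕ => (κ : ℝ)) neg

/-- Indistinguishability-based computational differential privacy. -/
def IndCDP (ε : ℕ → ℝ) (M : Mech T) : Prop :=
  ∃ neg : ℕ → ℝ, Negligible neg ∧
    ∀ A, IsNonuniformPPT A → ∀ p : Polynomial ℕ, ∀ᶠ κ in Filter.atTop,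
      ∀ D₁ D₂ : List T, D₁.length ≤ p.eval κ → D₂.length ≤ p.eval κ → Neighbor D₁ D₂ →
        prOne (A κ) (M κ D₁) ≤ Real.exp (ε κ) * prOne (A κ) (M κ D₂) + neg κ

/-- Simulation-based computational differential privacy. -/
def SimCDP (ε : ℕ → ℝ) (M : Mech T) : Prop :=
  ∃ M' : Mech T, (∀ κ, IsDP (ε κ) (M' κ)) ∧
    ∃ neg : ℕ → ℝ, Negligible neg ∧
      ∀ A, IsNonuniformPPT A → ∀ p : Polynomial ℕ, ∀ᶠ κ in Filter.atTop,
        ∀ D : List T, D.length ≤ p.eval κ →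
          prOne (A κ) (M κ D) - prOne (A κ) (M' κ D) ≤ neg κ

/-- Computational zero-knowledge privacy with respect to a model `Agg` of aggregate information
(a class of families of possibly randomized algorithms on datasets): for some `agg ∈ Agg` and some
polynomial-time simulator `Sim`, for neighboring `D₁` and `D₂`, the output of the mechanism on `D₁`
and the output of `Sim` on `agg(D₂)` are `ε`-indistinguishable, in both directions, for
computationally bounded distinguishers. -/
def CZKPrivate (Agg : Set (Mech T)) (ε : ℕ → ℝ) (M : Mech T) : Prop :=
  ∃ agg ∈ Agg, ∃ Sim : ℕ → Str → PMF Str, IsNonuniformPPT Sim ∧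
    ∃ neg : ℕ → ℝ, Negligible neg ∧
      ∀ A, IsNonuniformPPT A → ∀ p : Polynomial ℕ, ∀ᶠ κ in Filter.atTop,
        ∀ D₁ D₂ : List T, D₁.length ≤ p.eval κ → D₂.length ≤ p.eval κ → Neighbor D₁ D₂ →
          prOne (A κ) (M κ D₁) ≤
              Real.exp (ε κ) * prOne (A κ) ((agg κ D₂).bind (Sim κ)) + neg κ ∧
          prOne (A κ) ((agg κ D₂).bind (Sim κ)) ≤
              Real.exp (ε κ) * prOne (A κ) (M κ D₁) + neg κ

/-- Any two aggregates of the class can be recovered, each in polynomial time, from a third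
aggregate of the class. One-element classes are of this kind. -/
def AggDirected (Agg : Set (Mech T)) : Prop :=
  ∀ a₁ ∈ Agg, ∀ a₂ ∈ Agg, ∃ a ∈ Agg, ∃ g₁ g₂ : ℕ → Str → PMF Str,
    IsNonuniformPPT g₁ ∧ IsNonuniformPPT g₂ ∧
      ∀ κ D, (a κ D).bind (g₁ κ) = a₁ κ D ∧ (a κ D).bind (g₂ κ) = a₂ κ D

/-! ### Privacy axioms -/

/-- A coin that shows `true` with probability `p`. -/
noncomputable def biasedCoin (p : unitInterval) : PMF Bool :=
  PMF.ofFintype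
    (fun b => cond b (ENNReal.ofReal (p : ℝ)) (ENNReal.ofReal (1 - (p : ℝ)))) (by
      rw [Fintype.sum_bool, cond_true, cond_false, ← ENNReal.ofReal_add p.2.1 (by linarith [p.2.2])]
      simp)

/-- The mechanism that runs `M₁` with probability `p` and `M₂` with probability `1 - p`. -/
noncomputable def mix (p : unitInterval) (M₁ M₂ : Mech T) : Mech T :=
  fun κ D => (biasedCoin p).bind fun b => cond b (M₁ κ D) (M₂ κ D)

/-- The mechanism that applies `f` to the output of `M`. -/
noncomputable def postProcess (f : ℕ → Str → PMF Str) (M : Mech T) : Mech T :=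
  fun κ D => (M κ D).bind (f κ)

/-- The convexity axiom for a privacy definition. -/
def SatisfiesConvexity (Def : Mech T → Prop) : Prop :=
  ∀ M₁ M₂ : Mech T, Def M₁ → Def M₂ → ∀ p : unitInterval, Def (mix p M₁ M₂)

/-- The post-processing axiom for a privacy definition, restricted to functions computable in
probabilistic polynomial time (which may depend on the security parameter and use advice; those
of a uniform machine are the case of empty advice). -/
def SatisfiesPPTPostProcessing (Def : Mech T → Prop) : Prop :=
  ∀ M : Mech T, Def M → ∀ f : ℕ → Str → PMF Str, IsNonuniformPPT f → Def (postProcess f M)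

end

end CompDP

/-! Post-processing is a reduction: applying `f` and then a distinguisher is again a distinguisher
(`prOne_bind`), and it is non-uniform PPT by `IsNonuniformPPT.comp`. The negligible function is
chosen before the distinguisher, so it can be kept. The ideal mechanism of SimCDP is post-processed
too (`Indist.bind`), and a zero-knowledge simulator is composed with `f`.

For IndCDP and SimCDP, convexity holds because acceptance probabilities are affine in the mechanism
(`prOne_mix`), so the inequalities can be averaged.

Convexity of zero-knowledge privacy is harder: a single simulator must itself toss the coin of bias
`p` and, from the common aggregate, run `g₁` and `S₁` or `g₂` and `S₂`. Fair coins and bounded time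
give only dyadic biases, so it tosses a coin whose bias is `p` truncated to `κ` binary digits, taken
from the advice. An additive error `2^{-κ}` would be multiplied by `e^ε`, which may be huge. For `0
< p < 1` the error is instead put into a factor `1 + C 2^{-κ}` (`convexComb_le_of_approx`), which
costs only a negligible summand because probabilities are at most `1`
(`le_mul_add_of_le_mul_one_add`).

The machine constructions (sequencing, branching on a bit, biased coin) all rest on
`Placement.evals`, which simulates a machine inside a larger one. -/

namespace CompDP

open scoped ENNReal
open Turing

/-! ### Evaluation of probabilistic Turing machines -/

namespace ProbTM

variable {M N : ProbTM}

/-- Started at the configuration `c`, the machine halts within `t` steps whatever the coins are, and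
its output has distribution `μ`. -/
def Evals (M : ProbTM) (c : M.Cfg) (t : ℕ) (μ : PMF Str) : Prop :=
  (∀ c' ∈ (M.run t c).support, c'.l = none) ∧ (M.run t c).map (fun c' => c'.stk M.outStack) = μ

theorem step_of_halted {c : M.Cfg} (h : c.l = none) : M.step c = PMF.pure c := by
  unfold step; rw [h]

theorem step_of_label {c : M.Cfg} {l : M.Lab} (h : c.l = some l) :
    M.step c = (PMF.uniformOfFintype Bool).map
      fun b => TM2.stepAux (M.prog b l) c.var c.stk := by
  unfold step; rw [h]

theorem run_of_halted {c : M.Cfg} (h : c.l = none) (t : ℕ) : M.run t c = PMF.pure c := by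
  induction t with
  | zero => rfl
  | succ t ih => rw [run, step_of_halted h, PMF.pure_bind, ih]

theorem run_succ_of_label {c : M.Cfg} {l : M.Lab} (h : c.l = some l) (t : ℕ) :
    M.run (t + 1) c = (PMF.uniformOfFintype Bool).bind
      fun b => M.run t (TM2.stepAux (M.prog b l) c.var c.stk) := by
  rw [run, step_of_label h, PMF.bind_map]; rfl

theorem run_add (s t : ℕ) (c : M.Cfg) : M.run (t + s) c = (M.run t c).bind (M.run s) := by
  induction t generalizing c with
  | zero => rw [Nat.zero_add, run, PMF.pure_bind]
  | succ t ih =>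
    rw [Nat.add_right_comm, run, run, PMF.bind_bind]
    congr 1
    funext c'
    exact ih c'

/-- Halted configurations are fixed points of `step`, so time bounds may be rounded up freely. -/
theorem Evals.mono {c : M.Cfg} {t t' : ℕ} {μ : PMF Str} (h : M.Evals c t μ) (ht : t ≤ t') :
    M.Evals c t' μ := by
  obtain ⟨s, rfl⟩ := Nat.exists_eq_add_of_le ht
  have key : M.run (t + s) c = M.run t c := by
    rw [run_add]
    refine PMF.ext fun y => ?_
    rw [PMF.bind_apply]
    conv_rhs => rw [← PMF.bind_pure (M.run t c), PMF.bind_apply]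
    refine tsum_congr fun c' => ?_
    by_cases hc : c' ∈ (M.run t c).support
    · rw [run_of_halted (h.1 c' hc)]
    · rw [(PMF.apply_eq_zero_iff _ _).2 hc, zero_mul, zero_mul]
  rw [Evals, key]
  exact h

theorem evals_of_halted {c : M.Cfg} (h : c.l = none) :
    M.Evals c 0 (PMF.pure (c.stk M.outStack)) := by
  refine ⟨fun c' hc => ?_, ?_⟩
  · rw [run, PMF.mem_support_pure_iff] at hc
    rw [hc, h]
  · rw [run, PMF.pure_map]

theorem Evals.step {c : M.Cfg} {l : M.Lab} (h : c.l = some l) {t : ℕ} {ν : Bool → PMF Str}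
    (hν : ∀ b, M.Evals (TM2.stepAux (M.prog b l) c.var c.stk) t (ν b)) :
    M.Evals c (t + 1) ((PMF.uniformOfFintype Bool).bind ν) := by
  rw [Evals, run_succ_of_label h]
  refine ⟨fun c' hc => ?_, ?_⟩
  · obtain ⟨b, -, hb⟩ := (PMF.mem_support_bind_iff _ _ _).1 hc
    exact (hν b).1 c' hb
  · rw [PMF.map_bind]
    congr 1
    funext b
    exact (hν b).2

theorem Evals.step_const {c : M.Cfg} {l : M.Lab} (h : c.l = some l) {t : ℕ} {μ : PMF Str}
    (hμ : ∀ b, M.Evals (TM2.stepAux (M.prog b l) c.var c.stk) t μ) :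
    M.Evals c (t + 1) μ := by
  have := Evals.step h (ν := fun _ => μ) hμ
  rwa [PMF.bind_const] at this

/-! ### Growth of the stacks -/

/-- The number of push instructions of a statement. -/
def pushes {K Lab St : Type} : TM2.Stmt (fun _ : K => Bool) Lab St → ℕ
  | .push _ _ q => pushes q + 1
  | .peek _ _ q => pushes q
  | .pop _ _ q => pushes q
  | .load _ q => pushes q
  | .branch _ q₁ q₂ => pushes q₁ + pushes q₂
  | .goto _ => 0
  | .halt => 0

theorem length_stepAux_le {K Lab St : Type} [DecidableEq K]
    (q : TM2.Stmt (fun _ : K => Bool) Lab St) (v : St) (S : K → Str) (k : K) :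
    ((TM2.stepAux q v S).stk k).length ≤ (S k).length + pushes q := by
  induction q generalizing v S with
  | push k' f q ih =>
    refine (ih _ _).trans ?_
    rw [pushes]
    by_cases hk : k = k'
    · subst hk; simp; omega
    · rw [Function.update_of_ne hk]; omega
  | peek k' f q ih => exact ih _ _
  | pop k' f q ih =>
    refine (ih _ _).trans ?_
    rw [pushes]
    by_cases hk : k = k'
    · subst hk; simp
    · rw [Function.update_of_ne hk]
  | load f q ih => exact ih _ _
  | branch p q₁ q₂ ih₁ ih₂ =>
    rw [TM2.stepAux, pushes]
    cases p v
    · exact (ih₂ _ _).trans (by omega)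
    · exact (ih₁ _ _).trans (by omega)
  | goto f => simp [TM2.stepAux]
  | halt => simp [TM2.stepAux]

/-- A bound on the number of symbols pushed in one step. -/
def pushBound (M : ProbTM) : ℕ := ∑ b, ∑ l, pushes (M.prog b l)

theorem pushes_le_pushBound (b : Bool) (l : M.Lab) : pushes (M.prog b l) ≤ M.pushBound :=
  (Finset.single_le_sum (f := fun l => pushes (M.prog b l)) (fun _ _ => Nat.zero_le _)
    (Finset.mem_univ l)).trans
    (Finset.single_le_sum (f := fun b => ∑ l, pushes (M.prog b l)) (fun _ _ => Nat.zero_le _)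
      (Finset.mem_univ b))

/-- Needed for composition: the output of a polynomial-time machine has polynomial length, which
bounds the running time of the machine reading it. -/
theorem length_le_of_mem_support_run {t : ℕ} {c c' : M.Cfg} (h : c' ∈ (M.run t c).support)
    (k : M.K) : (c'.stk k).length ≤ (c.stk k).length + M.pushBound * t := by
  induction t generalizing c with
  | zero =>
    rw [run, PMF.mem_support_pure_iff] at h
    simp [h]
  | succ t ih =>
    rcases hl : c.l with _ | l
    · rw [run_of_halted hl, PMF.mem_support_pure_iff] at h
      simp [h]
    · rw [run_succ_of_label hl] at h
      obtain ⟨b, -, hb⟩ := (PMF.mem_support_bind_iff _ _ _).1 h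
      refine (ih hb).trans ?_
      have h₁ := length_stepAux_le (M.prog b l) c.var c.stk k
      have h₂ := pushes_le_pushBound b l
      rw [Nat.mul_succ]
      omega

/-! ### Submachines -/

/-- A placement of the machine `N` inside `M`: where its stacks, its labels and its internal state
are found in `M`, and where `M` goes on when `N` halts. -/
structure Placement (N M : ProbTM) where
  stack : N.K → M.K
  stack_injective : Function.Injective stack
  label : N.Lab → M.Lab
  get : M.St → N.St
  set : M.St → N.St → M.St
  get_set : ∀ s v, get (set s v) = v
  exit : Option M.Lab

/-- The translation of statements along a placement of machine components. -/
def trStmt {K K' Lab Lab' St St' : Type} (stack : K → K') (label : Lab → Lab') (get : St' → St)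
    (set : St' → St → St') (exit : Option Lab') :
    TM2.Stmt (fun _ : K => Bool) Lab St → TM2.Stmt (fun _ : K' => Bool) Lab' St'
  | .push k f q => .push (stack k) (fun s => f (get s)) (trStmt stack label get set exit q)
  | .peek k f q =>
    .peek (stack k) (fun s o => set s (f (get s) o)) (trStmt stack label get set exit q)
  | .pop k f q =>
    .pop (stack k) (fun s o => set s (f (get s) o)) (trStmt stack label get set exit q)
  | .load f q => .load (fun s => set s (f (get s))) (trStmt stack label get set exit q)
  | .branch p q₁ q₂ => .branch (fun s => p (get s)) (trStmt stack label get set exit q₁)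
      (trStmt stack label get set exit q₂)
  | .goto f => .goto fun s => label (f (get s))
  | .halt => match exit with
    | none => .halt
    | some l => .goto fun _ => l

namespace Placement

/-- The statement of `M` that corresponds to a statement of `N`. -/
abbrev tr (P : Placement N M) :
    TM2.Stmt (fun _ : N.K => Bool) N.Lab N.St → TM2.Stmt (fun _ : M.K => Bool) M.Lab M.St :=
  trStmt P.stack P.label P.get P.set P.exit

/-- The program of `M` at the labels of `N` is that of `N`. -/
def Respects (P : Placement N M) : Prop := ∀ b l, M.prog b (P.label l) = P.tr (N.prog b l)

/-- The configuration `C` of `M` represents the configuration `c` of `N`, with contents `F` of the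
stacks that do not belong to `N`. -/
structure Rel (P : Placement N M) (F : M.K → Str) (c : N.Cfg) (C : M.Cfg) : Prop where
  label : C.l = c.l.elim P.exit fun l => some (P.label l)
  var : P.get C.var = c.var
  stk : ∀ k, C.stk (P.stack k) = c.stk k
  frame : ∀ k, (∀ k', P.stack k' ≠ k) → C.stk k = F k

/-- Translated statements touch only stacks in the image of `P.stack`; injectivity keeps these
apart, and `get_set` makes state updates visible to `N`. -/
theorem rel_stepAux (P : Placement N M) (F : M.K → Str)
    (q : TM2.Stmt (fun _ : N.K => Bool) N.Lab N.St) (v : N.St) (V : M.St) (s : N.K → Str)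
    (S : M.K → Str) (hv : P.get V = v) (hs : ∀ k, S (P.stack k) = s k)
    (hF : ∀ k, (∀ k', P.stack k' ≠ k) → S k = F k) :
    P.Rel F (TM2.stepAux q v s) (TM2.stepAux (P.tr q) V S) := by
  have upd : ∀ (k : N.K) (L : Str) (s : N.K → Str) (S : M.K → Str),
      (∀ k, S (P.stack k) = s k) → ∀ k', Function.update S (P.stack k) L (P.stack k') =
        Function.update s k L k' := by
    intro k L s S hs k'
    by_cases hk : k' = k
    · subst hk; simp
    · rw [Function.update_of_ne hk, Function.update_of_ne (P.stack_injective.ne hk), hs]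
  have updF : ∀ (k : N.K) (L : Str) (S : M.K → Str),
      (∀ k, (∀ k', P.stack k' ≠ k) → S k = F k) →
      ∀ k', (∀ k'', P.stack k'' ≠ k') → Function.update S (P.stack k) L k' = F k' := by
    intro k L S hF k' hk'
    rw [Function.update_of_ne (hk' k).symm, hF k' hk']
  induction q generalizing v V s S with
  | push k f q ih =>
    simp only [TM2.stepAux, tr, trStmt]
    refine ih _ _ _ _ hv ?_ ?_
    · rw [hv, hs]; exact upd k _ s S hs
    · exact updF k _ S hF
  | peek k f q ih =>
    simp only [TM2.stepAux, tr, trStmt]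
    refine ih _ _ _ _ ?_ hs hF
    rw [P.get_set, hv, hs]
  | pop k f q ih =>
    simp only [TM2.stepAux, tr, trStmt]
    refine ih _ _ _ _ ?_ ?_ ?_
    · rw [P.get_set, hv, hs]
    · rw [hs]; exact upd k _ s S hs
    · exact updF k _ S hF
  | load f q ih =>
    simp only [TM2.stepAux, tr, trStmt]
    refine ih _ _ _ _ ?_ hs hF
    rw [P.get_set, hv]
  | branch p q₁ q₂ ih₁ ih₂ =>
    simp only [TM2.stepAux, tr, trStmt]
    rw [hv]
    cases p v
    · exact ih₂ _ _ _ _ hv hs hF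
    · exact ih₁ _ _ _ _ hv hs hF
  | goto f =>
    simp only [TM2.stepAux, tr, trStmt]
    exact ⟨by simp [hv], hv, hs, hF⟩
  | halt =>
    rcases he : P.exit with _ | l
    · simp only [TM2.stepAux, tr, trStmt, he]
      exact ⟨by simp [he], hv, hs, hF⟩
    · simp only [TM2.stepAux, tr, trStmt, he]
      exact ⟨by simp [he], hv, hs, hF⟩

/-- A run of the submachine, followed by a continuation that depends on its output. -/
theorem evals (P : Placement N M) (hP : P.Respects) {F : M.K → Str} {s t : ℕ}
    {ν : Str → PMF Str} {c : N.Cfg} {C : M.Cfg} (hR : P.Rel F c C) {μ : PMF Str}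
    (hc : N.Evals c t μ)
    (hν : ∀ c' ∈ (N.run t c).support, ∀ C', C'.l = P.exit → P.Rel F c' C' →
      M.Evals C' s (ν (c'.stk N.outStack))) :
    M.Evals C (t + s) (μ.bind ν) := by
  -- `N` may halt before its time is up, on some coin sequences only; the unused steps are then
  -- absorbed by `Evals.mono`.
  have halted : ∀ {c : N.Cfg} {C : M.Cfg} {t : ℕ} {μ : PMF Str}, c.l = none → P.Rel F c C →
      N.Evals c t μ → (∀ c' ∈ (N.run t c).support, ∀ C', C'.l = P.exit → P.Rel F c' C' →
      M.Evals C' s (ν (c'.stk N.outStack))) → M.Evals C (t + s) (μ.bind ν) := by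
    intro c C t μ hl hR hc hν
    rw [← hc.2, run_of_halted hl, PMF.pure_map, PMF.pure_bind]
    refine (hν c ?_ C ?_ hR).mono (Nat.le_add_left _ _)
    · rw [run_of_halted hl, PMF.mem_support_pure_iff]
    · rw [hR.label, hl]; rfl
  induction t generalizing c C μ with
  | zero =>
    refine halted ?_ hR hc hν
    exact hc.1 c (by rw [run, PMF.mem_support_pure_iff])
  | succ t ih =>
    rcases hl : c.l with _ | l
    · exact halted hl hR hc hν
    · have hsup : ∀ b, ∀ c' ∈ (N.run t (TM2.stepAux (N.prog b l) c.var c.stk)).support,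
          c' ∈ (N.run (t + 1) c).support := by
        intro b c' hc'
        rw [run_succ_of_label hl]
        exact (PMF.mem_support_bind_iff _ _ _).2 ⟨b, by simp, hc'⟩
      have hμ := hc.2
      rw [run_succ_of_label hl, PMF.map_bind] at hμ
      rw [← hμ, PMF.bind_bind, Nat.add_right_comm]
      have hCl : C.l = some (P.label l) := by rw [hR.label, hl]; rfl
      refine Evals.step hCl fun b => ?_
      refine ih (c := TM2.stepAux (N.prog b l) c.var c.stk) ?_
        ⟨fun c' hc' => hc.1 c' (hsup b c' hc'), rfl⟩ fun c' hc' => hν c' (hsup b c' hc')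
      rw [hP b l]
      exact P.rel_stepAux F _ _ _ _ _ hR.var hR.stk hR.frame

/-- A run of a submachine at whose end the machine halts. -/
theorem evals_of_exit_eq_none (P : Placement N M) (hP : P.Respects) (hexit : P.exit = none)
    (hout : P.stack N.outStack = M.outStack) {F : M.K → Str} {t : ℕ} {c : N.Cfg} {C : M.Cfg}
    (hR : P.Rel F c C) {μ : PMF Str} (hc : N.Evals c t μ) : M.Evals C t μ := by
  have := P.evals hP (s := 0) (ν := PMF.pure) hR hc fun c' _ C' hC' hR' => by
    rw [← hR'.stk, hout]
    exact evals_of_halted (hC'.trans hexit)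
  rwa [PMF.bind_pure] at this

end Placement

/-! ### Moving the contents of a stack -/

/-- Pop a symbol from `src`; if there is one, push it to `dst` and go to `l`, otherwise continue with
`q`. -/
def moveStmt {K Lab St : Type} (put : St → Option Bool → St) (sym : St → Option Bool)
    (src dst : K) (l : Lab) (q : TM2.Stmt (fun _ : K => Bool) Lab St) :
    TM2.Stmt (fun _ : K => Bool) Lab St :=
  .pop src put <| .branch (fun s => (sym s).isSome)
    (.push dst (fun s => (sym s).getD false) (.goto fun _ => l)) q

/-- One step per symbol, and one more in which the pop finds `src` empty and `q` is executed. The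
order of the symbols is reversed. -/
theorem evals_move {put : M.St → Option Bool → M.St} {sym : M.St → Option Bool}
    (hput : ∀ s o, sym (put s o) = o) {src dst : M.K} (hne : src ≠ dst) {l : M.Lab}
    {q : TM2.Stmt (fun _ : M.K => Bool) M.Lab M.St}
    (hprog : ∀ b, M.prog b l = moveStmt put sym src dst l q) {t : ℕ} {μ : PMF Str}
    {v : M.St} {S : M.K → Str}
    (hq : ∀ v' S', S' src = [] → S' dst = (S src).reverse ++ S dst →
      (∀ k, k ≠ src → k ≠ dst → S' k = S k) → M.Evals (TM2.stepAux q v' S') t μ) :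
    M.Evals ⟨some l, v, S⟩ (t + (S src).length + 1) μ := by
  generalize hL : S src = L at hq ⊢
  induction L generalizing v S with
  | nil =>
    refine Evals.step_const (l := l) rfl fun b => ?_
    rw [hprog b]
    simp only [moveStmt, TM2.stepAux, hL, hput, List.head?_nil, Option.isSome_none, cond_false]
    refine hq _ _ (by simp) ?_ fun k h₁ _ => Function.update_of_ne h₁ _ _
    rw [Function.update_of_ne hne.symm]; rfl
  | cons x L ih =>
    refine Evals.step_const (l := l) rfl fun b => ?_
    rw [hprog b]
    simp only [moveStmt, TM2.stepAux, hL, hput, List.head?_cons, Option.isSome_some, cond_true,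
      Option.getD_some, List.tail_cons]
    refine ih ?_ fun v' S' h₁ h₂ h₃ => hq v' S' h₁ ?_ fun k hk hk' => ?_
    · rw [Function.update_of_ne hne, Function.update_self]
    · rw [h₂, Function.update_self, Function.update_of_ne hne.symm]; simp
    · rw [h₃ k hk hk', Function.update_of_ne hk', Function.update_of_ne hk]

end ProbTM

/-! ### Closure properties of non-uniform polynomial time -/

theorem eval_le_eval_of_le (p : Polynomial ℕ) {m n : ℕ} (h : m ≤ n) : p.eval m ≤ p.eval n := by
  rw [Polynomial.eval_eq_sum, Polynomial.eval_eq_sum]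
  exact Finset.sum_le_sum fun i _ => Nat.mul_le_mul_left _ (Nat.pow_le_pow_left h i)

namespace ProbTM

theorem length_initCfg_le (M : ProbTM) (κ : ℕ) (z : M.K → Str) (x : Str) (k : M.K) :
    ((M.initCfg κ z x).stk k).length ≤ κ + x.length + (z k).length := by
  simp only [initCfg]
  split_ifs
  · omega
  · rw [List.length_replicate]; omega
  · omega

/-- The machine that runs `A`, moves its output to the input stack of `B`, and runs `B`. -/
def seqTM (A B : ProbTM) : ProbTM where
  K := Option (A.K ⊕ B.K)
  Lab := Bool ⊕ (A.Lab ⊕ B.Lab)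
  St := Option Bool × A.St × B.St
  start := .inr (.inl A.start)
  init := (none, A.init, B.init)
  secStack := some (.inl A.secStack)
  inStack := some (.inl A.inStack)
  sec_ne_in := by simpa using A.sec_ne_in
  outStack := some (.inr B.outStack)
  prog b
    -- A move reverses the string, so it passes through the auxiliary stack `none` and is moved
    -- twice.
    | .inl false => moveStmt (fun s o => (o, s.2)) Prod.fst (some (.inl A.outStack)) none (.inl false)
        (.goto fun _ => .inl true)
    | .inl true => moveStmt (fun s o => (o, s.2)) Prod.fst none (some (.inr B.inStack)) (.inl true)
        (.load (fun s => (s.1, s.2.1, B.init)) (.goto fun _ => .inr (.inr B.start)))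
    | .inr (.inl l) => trStmt (fun k => some (.inl k)) (fun l => .inr (.inl l)) (fun s => s.2.1)
        (fun s v => (s.1, v, s.2.2)) (some (.inl false)) (A.prog b l)
    | .inr (.inr l) => trStmt (fun k => some (.inr k)) (fun l => .inr (.inr l)) (fun s => s.2.2)
        (fun s v => (s.1, s.2.1, v)) none (B.prog b l)

/-- The advice of `seqTM`: the security parameter is handed over to the second machine as part of
the advice. -/
def seqAdvice (A B : ProbTM) (κ : ℕ) (zA : A.K → Str) (zB : B.K → Str) : (seqTM A B).K → Str
  | none => []
  | some (.inl k) => zA k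
  | some (.inr k) => (B.initCfg κ zB []).stk k

/-- The first machine as a part of `seqTM`. -/
def seqFst (A B : ProbTM) : Placement A (seqTM A B) where
  stack k := some (.inl k)
  stack_injective _ _ h := Sum.inl_injective (Option.some_injective _ h)
  label l := .inr (.inl l)
  get s := s.2.1
  set s v := (s.1, v, s.2.2)
  get_set _ _ := rfl
  exit := some (.inl false)

/-- The second machine as a part of `seqTM`. -/
def seqSnd (A B : ProbTM) : Placement B (seqTM A B) where
  stack k := some (.inr k)
  stack_injective _ _ h := Sum.inr_injective (Option.some_injective _ h)
  label l := .inr (.inr l)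
  get s := s.2.2
  set s v := (s.1, s.2.1, v)
  get_set _ _ := rfl
  exit := none

/-- Here `m` bounds the length of the intermediate string; each of the two moves takes at most `m +
1` steps. -/
theorem seqTM_outputsWithin {A B : ProbTM} {κ : ℕ} {zA : A.K → Str} {zB : B.K → Str} {x : Str}
    {s t m : ℕ} {μ : PMF Str} {ν : Str → PMF Str} (hA : A.OutputsWithin κ zA x t μ)
    (hm : κ + x.length + (zA A.outStack).length + A.pushBound * t ≤ m)
    (hB : ∀ y : Str, y.length ≤ m → B.OutputsWithin κ zB y s (ν y)) :
    (seqTM A B).OutputsWithin κ (seqAdvice A B κ zA zB) x (t + (s + 2 * m + 2)) (μ.bind ν) := by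
  let F : (seqTM A B).K → Str := seqAdvice A B κ zA zB
  have hR : (seqFst A B).Rel F (A.initCfg κ zA x)
      ((seqTM A B).initCfg κ (seqAdvice A B κ zA zB) x) := by
    refine ⟨rfl, rfl, fun k => ?_, fun k hk => ?_⟩
    · simp [initCfg, seqFst, seqTM, seqAdvice]
    · match k, hk with
      | none, _ => simp [initCfg, seqTM, F]
      | some (.inl k), hk => exact absurd rfl (hk k)
      | some (.inr k), _ => simp [initCfg, seqTM, F]
  refine (seqFst A B).evals (fun _ _ => rfl) hR hA fun c' hc' C' hl hR' => ?_
  have hlen : (c'.stk A.outStack).length ≤ m := by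
    have h₁ := length_le_of_mem_support_run hc' A.outStack
    have h₂ := length_initCfg_le A κ zA x A.outStack
    omega
  obtain ⟨l, v, S⟩ := C'
  obtain rfl : l = some (.inl false) := hl
  have hS : ∀ k, S (some (.inl k)) = c'.stk k := hR'.stk
  have hSn : S none = [] := hR'.frame none fun k' h => by simp [seqFst] at h
  have hSr : ∀ k, S (some (.inr k)) = (B.initCfg κ zB []).stk k := fun k =>
    hR'.frame (some (.inr k)) fun _ h => Sum.inl_ne_inr (Option.some_injective _ h)
  suffices h : (seqTM A B).Evals ⟨some (.inl false), v, S⟩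
      (s + (c'.stk A.outStack).length + 1 + (c'.stk A.outStack).length + 1)
      (ν (c'.stk A.outStack)) from h.mono (by omega)
  generalize hy : c'.stk A.outStack = y at hlen
  have hSy : S (some (.inl A.outStack)) = y := by rw [hS, hy]
  rw [← congrArg List.length hSy]
  refine evals_move (M := seqTM A B) (put := fun s o => (o, s.2)) (sym := Prod.fst)
    (fun _ _ => rfl) (src := some (.inl A.outStack)) (dst := none) (Option.some_ne_none _)
    (fun _ => rfl)
    fun v' S' _ h₂ h₃ => ?_
  rw [hSy, hSn, List.append_nil] at h₂
  have hlen' : (S (some (.inl A.outStack))).length = (S' none).length := by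
    rw [hSy, h₂, List.length_reverse]
  rw [hlen']
  refine evals_move (M := seqTM A B) (put := fun s o => (o, s.2)) (sym := Prod.fst)
    (fun _ _ => rfl) (src := none) (dst := some (.inr B.inStack)) (Option.some_ne_none _).symm
    (fun _ => rfl)
    fun v'' S'' _ h₅ h₆ => ?_
  have hS'r : ∀ k, S' (some (.inr k)) = (B.initCfg κ zB []).stk k := fun k =>
    (h₃ _ (fun h => Sum.inr_ne_inl (Option.some_injective _ h)) (Option.some_ne_none _)).trans
      (hSr k)
  refine (seqSnd A B).evals_of_exit_eq_none (fun _ _ => rfl) rfl rfl (F := S'')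
    (c := B.initCfg κ zB y) ⟨rfl, rfl, fun k => ?_, fun _ _ => rfl⟩ (hB y hlen)
  by_cases hk : k = B.inStack
  · subst hk
    refine h₅.trans ?_
    rw [h₂, hS'r]
    simp [initCfg]
  · refine (h₆ (some (.inr k)) (Option.some_ne_none _) fun h =>
      hk (Sum.inr_injective (Option.some_injective _ h))).trans ?_
    rw [hS'r]
    simp [initCfg, hk]

end ProbTM

open ProbTM

theorem IsNonuniformPPT.comp {A B : ℕ → Str → PMF Str} (hA : IsNonuniformPPT A)
    (hB : IsNonuniformPPT B) : IsNonuniformPPT fun κ x => (A κ x).bind (B κ) := by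
  obtain ⟨M, zM, aM, tM, haM, hM⟩ := hA
  obtain ⟨N, zN, aN, tN, haN, hN⟩ := hB
  -- What the output stack of `M` may hold initially, plus what can be pushed in time `tM`. The `.X`
  -- in the advice bound below pays for the copy of `1^κ` given to `N`.
  let m : Polynomial ℕ := .X + aM + .C M.pushBound * tM
  refine ⟨seqTM M N, fun κ => seqAdvice M N κ (zM κ) (zN κ), aM + aN + .X,
    tM + (tN.comp (.X + m) + 2 * m + 2), fun κ k => ?_, fun κ x => ?_⟩
  · simp only [Polynomial.eval_add, Polynomial.eval_X]
    match k with
    | none => simp [seqAdvice]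
    | some (.inl k) => exact (haM κ k).trans (by omega)
    | some (.inr k) =>
      refine (length_initCfg_le N κ (zN κ) [] k).trans ?_
      have := haN κ k
      simp only [List.length_nil]
      omega
  · have hm : κ + x.length + (zM κ M.outStack).length + M.pushBound * tM.eval (κ + x.length) ≤
        m.eval (κ + x.length) := by
      have h₁ := haM κ M.outStack
      have h₂ := eval_le_eval_of_le aM (Nat.le_add_right κ x.length)
      simp only [m, Polynomial.eval_add, Polynomial.eval_X, Polynomial.eval_mul,
        Polynomial.eval_C]
      omega
    have := seqTM_outputsWithin (s := tN.eval (κ + x.length + m.eval (κ + x.length))) (hM κ x) hm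
      fun y hy => Evals.mono (hN κ y) (eval_le_eval_of_le tN (by omega))
    simpa [Polynomial.eval_comp] using this

/-- The machine that halts at once, leaving its input as output. -/
def idTM : ProbTM where
  K := Bool
  Lab := Unit
  St := Unit
  start := ()
  init := ()
  secStack := false
  inStack := true
  sec_ne_in := by simp
  outStack := true
  prog _ _ := .halt

theorem idTM_outputsWithin (κ : ℕ) (x : Str) :
    idTM.OutputsWithin κ (fun _ => []) x 1 (PMF.pure x) :=
  Evals.step_const (l := ()) rfl fun _ => evals_of_halted rfl

/-- A polynomial-time family can be computed by a machine with an output stack that is initially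
empty and different from those of the input and the security parameter. -/
theorem IsNonuniformPPT.exists_separate_output {A : ℕ → Str → PMF Str} (hA : IsNonuniformPPT A) :
    ∃ (M : ProbTM) (z : ℕ → M.K → Str) (a t : Polynomial ℕ),
      (∀ κ k, (z κ k).length ≤ a.eval κ) ∧
      (∀ κ x, M.OutputsWithin κ (z κ) x (t.eval (κ + x.length)) (A κ x)) ∧
      M.outStack ≠ M.inStack ∧ M.outStack ≠ M.secStack ∧ ∀ κ, z κ M.outStack = [] := by
  obtain ⟨M, zM, aM, tM, haM, hM⟩ := hA
  let m : Polynomial ℕ := .X + aM + .C M.pushBound * tM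
  -- Sequencing with `idTM` copies the output to a stack of the second summand, which is fresh and
  -- empty at the start.
  refine ⟨seqTM M idTM, fun κ => seqAdvice M idTM κ (zM κ) fun _ => [], aM + .X,
    tM + (1 + 2 * m + 2), fun κ k => ?_, fun κ x => ?_, by simp [seqTM], by simp [seqTM],
    fun κ => by simp [seqTM, seqAdvice, initCfg, idTM]⟩
  · simp only [Polynomial.eval_add, Polynomial.eval_X]
    match k with
    | none => simp [seqAdvice]
    | some (.inl k) => exact (haM κ k).trans (by omega)
    | some (.inr k) =>
      refine (length_initCfg_le idTM κ (fun _ => []) [] k).trans ?_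
      simp
  · have hm : κ + x.length + (zM κ M.outStack).length + M.pushBound * tM.eval (κ + x.length) ≤
        m.eval (κ + x.length) := by
      have h₁ := haM κ M.outStack
      have h₂ := eval_le_eval_of_le aM (Nat.le_add_right κ x.length)
      simp only [m, Polynomial.eval_add, Polynomial.eval_X, Polynomial.eval_mul,
        Polynomial.eval_C]
      omega
    have := seqTM_outputsWithin (hM κ x) hm fun y _ => idTM_outputsWithin κ y
    rw [PMF.bind_pure] at this
    simpa using this

/-! ### Branching -/

namespace ProbTM

/-- The stacks of the machines `N b` inside `branchTM N`: those of the input, the security parameter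
and the output are shared. -/
def branchStack (N : Bool → ProbTM) (b : Bool) (k : (N b).K) : Fin 3 ⊕ (Σ b, (N b).K) :=
  if k = (N b).inStack then .inl 0
  else if k = (N b).secStack then .inl 1
  else if k = (N b).outStack then .inl 2
  else .inr ⟨b, k⟩

theorem branchStack_injective (N : Bool → ProbTM) (b : Bool) :
    Function.Injective (branchStack N b) := by
  intro k k' h
  simp only [branchStack] at h
  split_ifs at h <;> simp_all

/-- The machine that removes the first symbol `b` of the input and runs `N b`. -/
def branchTM (N : Bool → ProbTM) : ProbTM where
  K := Fin 3 ⊕ (Σ b, (N b).K)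
  Lab := Option (Σ b, (N b).Lab)
  St := Bool × (∀ b, (N b).St)
  start := none
  init := (false, fun b => (N b).init)
  secStack := .inl 1
  inStack := .inl 0
  sec_ne_in := by simp
  outStack := .inl 2
  prog c
    -- On empty input the default `false` agrees with `x.headD false`.
    | none => .pop (.inl 0) (fun s o => (o.getD false, s.2))
        (.goto fun s => some ⟨s.1, (N s.1).start⟩)
    | some ⟨b, l⟩ => trStmt (branchStack N b) (fun l => some ⟨b, l⟩) (fun s => s.2 b)
        (fun s v => (s.1, Function.update s.2 b v)) none ((N b).prog c l)

/-- The machine `N b` as a part of `branchTM N`. -/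
def branchPart (N : Bool → ProbTM) (b : Bool) : Placement (N b) (branchTM N) where
  stack := branchStack N b
  stack_injective := branchStack_injective N b
  label l := some ⟨b, l⟩
  get s := s.2 b
  set s v := (s.1, Function.update s.2 b v)
  get_set _ _ := Function.update_self ..
  exit := none

/-- Both machines must deliver on the one stack `.inl 2`, which starts empty; hence the conditions
on their output stacks. -/
theorem branchTM_outputsWithin {N : Bool → ProbTM} (hin : ∀ b, (N b).outStack ≠ (N b).inStack)
    (hsec : ∀ b, (N b).outStack ≠ (N b).secStack) {κ : ℕ} {z : ∀ b, (N b).K → Str}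
    (hz : ∀ b, z b (N b).outStack = []) {x : Str} {t : ℕ} {μ : PMF Str}
    (h : (N (x.headD false)).OutputsWithin κ (z (x.headD false)) x.tail t μ) :
    (branchTM N).OutputsWithin κ (Sum.elim (fun _ => []) fun k => z k.1 k.2) x (t + 1) μ := by
  refine Evals.step_const (l := none) rfl fun c => ?_
  set C := TM2.stepAux ((branchTM N).prog c none) ((branchTM N).initCfg κ
    (Sum.elim (fun _ => []) fun k => z k.1 k.2) x).var ((branchTM N).initCfg κ
    (Sum.elim (fun _ => []) fun k => z k.1 k.2) x).stk with hC
  have hb : x.headD false = x.head?.getD false := by cases x <;> rfl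
  rw [hb] at h
  refine (branchPart N (x.head?.getD false)).evals_of_exit_eq_none (fun _ _ => rfl) rfl ?_
    (F := C.stk) (c := (N (x.head?.getD false)).initCfg κ (z _) x.tail)
    ⟨?_, ?_, fun k => ?_, fun _ _ => rfl⟩ h
  · simp [branchPart, branchStack, branchTM, hin, hsec]
  · simp [hC, branchTM, TM2.stepAux, initCfg, branchPart]
  · simp [hC, branchTM, TM2.stepAux, initCfg, branchPart]
  · simp only [hC, branchTM, TM2.stepAux, initCfg, branchPart, branchStack]
    by_cases h₁ : k = (N (x.head?.getD false)).inStack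
    · simp [h₁]
    by_cases h₂ : k = (N (x.head?.getD false)).secStack
    · subst h₂
      simp [h₁]
    by_cases h₃ : k = (N (x.head?.getD false)).outStack
    · subst h₃
      simp [h₁, h₂, hz]
    · simp [h₁, h₂, h₃]

end ProbTM

theorem IsNonuniformPPT.branch {A : Bool → ℕ → Str → PMF Str} (hA : ∀ b, IsNonuniformPPT (A b)) :
    IsNonuniformPPT fun κ x => A (x.headD false) κ x.tail := by
  choose N z a t ha hN hin hsec hz using fun b => (hA b).exists_separate_output
  refine ⟨branchTM N, fun κ => Sum.elim (fun _ => []) fun k => z k.1 κ k.2, a true + a false,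
    t true + t false + 1, fun κ k => ?_, fun κ x => ?_⟩
  · rcases k with k | ⟨b, k⟩
    · simp
    · have := ha b κ k
      cases b <;> simp only [Sum.elim_inr, Polynomial.eval_add] <;> omega
  · rw [Polynomial.eval_add, Polynomial.eval_one]
    refine branchTM_outputsWithin hin hsec (z := fun b => z b κ) (fun b => hz b κ) ?_
    refine Evals.mono (hN _ κ _) ?_
    refine (eval_le_eval_of_le _ (n := κ + x.length) (by simp)).trans ?_
    cases x.headD false <;> simp

/-! ### Biased coins -/

/-- Compare fair coins with the given bits, until there is a difference: the number whose binary
digits are these bits is the probability that the coins give a smaller number. -/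
noncomputable def bitsCoin : List Bool → PMF Bool
  | [] => PMF.pure false
  | d :: ds => (PMF.uniformOfFintype Bool).bind fun b => if b = d then bitsCoin ds else PMF.pure d

/-- The machine that tosses a coin with the bias given by the bits on its advice stack, and adds the
result to the input. -/
def coinTM : ProbTM where
  K := Fin 3
  Lab := Unit
  St := Option Bool
  start := ()
  init := none
  secStack := 1
  inStack := 0
  sec_ne_in := by simp
  outStack := 0
  -- The coin of the step is `b`. When the digits run out, `none` differs from `some b` and the
  -- default `false` is the result.
  prog b _ := .pop 2 (fun _ o => o) (.branch (fun s => decide (s = some b)) (.goto fun _ => ())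
    (.push 0 (fun s => s.getD false) .halt))

theorem coinTM_evals (ds : List Bool) (v : Option Bool) (S : Fin 3 → Str) (hS : S 2 = ds) :
    coinTM.Evals ⟨some (), v, S⟩ (ds.length + 1) ((bitsCoin ds).map fun b => b :: S 0) := by
  induction ds generalizing v S with
  | nil =>
    rw [bitsCoin, PMF.pure_map]
    refine Evals.step_const (l := ()) rfl fun b => ?_
    have hstep : TM2.stepAux (coinTM.prog b ()) v S =
        (⟨none, none, Function.update (Function.update S (2 : Fin 3) []) (0 : Fin 3) (false :: S 0)⟩ : coinTM.Cfg) := by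
      simp [coinTM, TM2.stepAux, hS]
    exact hstep ▸ evals_of_halted rfl
  | cons d ds ih =>
    rw [bitsCoin, PMF.map_bind]
    refine Evals.step (l := ()) rfl fun b => ?_
    by_cases hb : b = d
    · subst hb
      have hstep : TM2.stepAux (coinTM.prog b ()) v S =
          (⟨some (), some b, Function.update S (2 : Fin 3) ds⟩ : coinTM.Cfg) := by
        simp [coinTM, TM2.stepAux, hS]
      rw [if_pos rfl]
      exact hstep ▸ ih (some b) (Function.update S 2 ds) (by simp)
    · have hstep : TM2.stepAux (coinTM.prog b ()) v S =
          (⟨none, some d, Function.update (Function.update S (2 : Fin 3) ds) (0 : Fin 3) (d :: S 0)⟩ :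
            coinTM.Cfg) := by
        simp [coinTM, TM2.stepAux, hS, Ne.symm hb]
      rw [if_neg hb, PMF.pure_map]
      exact Evals.mono (hstep ▸ evals_of_halted rfl) (Nat.zero_le _)

theorem isNonuniformPPT_bitsCoin (d : ℕ → List Bool) (hd : ∀ κ, (d κ).length = κ) :
    IsNonuniformPPT fun κ x => (bitsCoin (d κ)).map fun b => b :: x := by
  refine ⟨coinTM, fun κ _ => d κ, .X, .X + 1, fun κ _ => by simp [hd], fun κ x => ?_⟩
  refine Evals.mono (coinTM_evals (d κ) none (coinTM.initCfg κ (fun _ => d κ) x).stk rfl) ?_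
  simp [hd]

/-- Tossing a coin with a bias of polynomially many bits, and applying one of two polynomial-time
families. -/
theorem IsNonuniformPPT.bitsCoin_bind {A₁ A₂ : ℕ → Str → PMF Str} (h₁ : IsNonuniformPPT A₁)
    (h₂ : IsNonuniformPPT A₂) (d : ℕ → List Bool) (hd : ∀ κ, (d κ).length = κ) :
    IsNonuniformPPT fun κ x => (bitsCoin (d κ)).bind fun b => cond b (A₁ κ x) (A₂ κ x) := by
  -- The coin is passed on as the first symbol of the input, which the branching machine removes.
  have := (isNonuniformPPT_bitsCoin d hd).comp
    (IsNonuniformPPT.branch (A := fun b => cond b A₁ A₂) (by rintro (_ | _) <;> assumption))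
  convert this using 3 with κ x
  rw [PMF.bind_map]
  congr 1
  funext b
  cases b <;> rfl

/-! ### Acceptance probabilities -/

theorem prOne_nonneg (A : Str → PMF Str) (μ : PMF Str) : 0 ≤ prOne A μ := ENNReal.toReal_nonneg

theorem prOne_le_one (A : Str → PMF Str) (μ : PMF Str) : prOne A μ ≤ 1 :=
  ENNReal.toReal_le_of_le_ofReal zero_le_one (ENNReal.ofReal_one ▸ PMF.coe_le_one _ _)

theorem prOne_bind (A f : Str → PMF Str) (μ : PMF Str) :
    prOne A (μ.bind f) = prOne (fun x => (f x).bind A) μ := by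
  rw [prOne, prOne, PMF.bind_bind]

theorem toReal_apply_false (c : PMF Bool) : (c false).toReal = 1 - (c true).toReal := by
  have h := c.tsum_coe
  rw [tsum_bool] at h
  have := congrArg ENNReal.toReal h
  rw [ENNReal.toReal_add (PMF.apply_ne_top _ _) (PMF.apply_ne_top _ _), ENNReal.toReal_one] at this
  linarith

theorem prOne_coin_bind (A : Str → PMF Str) (c : PMF Bool) (μ ν : PMF Str) :
    prOne A (c.bind fun b => cond b μ ν) =
      (c true).toReal * prOne A μ + (1 - (c true).toReal) * prOne A ν := by
  rw [← toReal_apply_false, prOne, PMF.bind_bind, PMF.bind_apply, tsum_bool,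
    ENNReal.toReal_add (ENNReal.mul_ne_top (PMF.apply_ne_top _ _) (PMF.apply_ne_top _ _))
      (ENNReal.mul_ne_top (PMF.apply_ne_top _ _) (PMF.apply_ne_top _ _)),
    ENNReal.toReal_mul, ENNReal.toReal_mul, add_comm]
  rfl

theorem toReal_biasedCoin_true (p : unitInterval) : (biasedCoin p true).toReal = p :=
  ENNReal.toReal_ofReal p.2.1

section
variable {T : Type*}

theorem prOne_mix (A : Str → PMF Str) (p : unitInterval) (M₁ M₂ : Mech T) (κ : ℕ) (D : List T) :
    prOne A (mix p M₁ M₂ κ D) = p * prOne A (M₁ κ D) + (1 - p) * prOne A (M₂ κ D) := by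
  rw [mix, prOne_coin_bind, toReal_biasedCoin_true]

theorem Negligible.mix {n₁ n₂ : ℕ → ℝ} (h₁ : Negligible n₁) (h₂ : Negligible n₂) (p : ℝ) :
    Negligible fun κ => p * n₁ κ + (1 - p) * n₂ κ :=
  (h₁.const_mul p).add (h₂.const_mul (1 - p))

theorem negligible_const_mul_two_pow (c : ℝ) : Negligible fun κ => c * (1 / 2) ^ κ :=
  Asymptotics.SuperpolynomialDecay.const_mul
    (fun n => tendsto_pow_const_mul_const_pow_of_lt_one n (by norm_num) (by norm_num)) c

theorem Negligible.abs {n : ℕ → ℝ} (h : Negligible n) : Negligible fun κ => |n κ| :=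
  Asymptotics.SuperpolynomialDecay.trans_abs_le h fun κ => (abs_abs (n κ)).le

/-! ### Indistinguishability -/

/-- The probability of a set is a sum of point masses, so the inequalities can be compared term by
term. -/
theorem indist_iff {ε : ℝ} {μ ν : PMF Str} : Indist ε μ ν ↔
    ∀ x, μ x ≤ ENNReal.ofReal (Real.exp ε) * ν x ∧ ν x ≤ ENNReal.ofReal (Real.exp ε) * μ x := by
  refine ⟨fun h x => by
    simpa only [PMF.toOuterMeasure_apply_singleton] using h {x}, fun h S => ?_⟩
  simp only [PMF.toOuterMeasure_apply, ← ENNReal.tsum_mul_left]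
  constructor <;> refine ENNReal.tsum_le_tsum fun x => ?_ <;> by_cases hx : x ∈ S <;>
    simp [hx, h x]

theorem Indist.bind {ε : ℝ} {μ ν : PMF Str} (h : Indist ε μ ν) (f : Str → PMF Str) :
    Indist ε (μ.bind f) (ν.bind f) := by
  rw [indist_iff] at h ⊢
  intro y
  simp only [PMF.bind_apply, ← ENNReal.tsum_mul_left, ← mul_assoc]
  exact ⟨ENNReal.tsum_le_tsum fun x => mul_le_mul_left (h x).1 _,
    ENNReal.tsum_le_tsum fun x => mul_le_mul_left (h x).2 _⟩

theorem Indist.coin_bind {ε : ℝ} {μ₁ ν₁ μ₂ ν₂ : PMF Str} (h₁ : Indist ε μ₁ ν₁)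
    (h₂ : Indist ε μ₂ ν₂) (c : PMF Bool) :
    Indist ε (c.bind fun b => cond b μ₁ μ₂) (c.bind fun b => cond b ν₁ ν₂) := by
  rw [indist_iff] at h₁ h₂ ⊢
  intro y
  simp only [PMF.bind_apply, ← ENNReal.tsum_mul_left]
  constructor <;> refine ENNReal.tsum_le_tsum fun b => ?_ <;> rw [mul_left_comm] <;> cases b
  · exact mul_le_mul_right (h₂ y).1 _
  · exact mul_le_mul_right (h₁ y).1 _
  · exact mul_le_mul_right (h₂ y).2 _
  · exact mul_le_mul_right (h₁ y).2 _

/-! ### Dyadic approximation of a bias -/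

/-- The first `n` binary digits of `r`. -/
noncomputable def binaryDigits : ℕ → ℝ → List Bool
  | 0, _ => []
  | n + 1, r => if 1 / 2 ≤ r then true :: binaryDigits n (2 * r - 1)
      else false :: binaryDigits n (2 * r)

theorem length_binaryDigits (n : ℕ) (r : ℝ) : (binaryDigits n r).length = n := by
  induction n generalizing r with
  | zero => rfl
  | succ n ih => rw [binaryDigits]; split_ifs <;> simp [ih]

/-- With probability `1/2` the fair coin agrees with `d` and the comparison moves on to `ds`;
otherwise the result is `d`. -/
theorem toReal_bitsCoin_cons (d : Bool) (ds : List Bool) :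
    (bitsCoin (d :: ds) true).toReal = (cond d 1 0 + (bitsCoin ds true).toReal) / 2 := by
  have h2 : (2⁻¹ * bitsCoin ds true : ℝ≥0∞) ≠ ⊤ :=
    ENNReal.mul_ne_top (by simp) (PMF.apply_ne_top _ _)
  rw [bitsCoin, PMF.bind_apply, tsum_bool]
  cases d
  · simp; ring
  · simp [ENNReal.toReal_add, h2]; ring

theorem bitsCoin_binaryDigits (n : ℕ) {r : ℝ} (h0 : 0 ≤ r) (h1 : r ≤ 1) :
    (bitsCoin (binaryDigits n r) true).toReal ≤ r ∧
      r - (1 / 2) ^ n ≤ (bitsCoin (binaryDigits n r) true).toReal := by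
  induction n generalizing r with
  | zero => simpa [binaryDigits, bitsCoin, h0] using h1
  | succ n ih =>
    rw [binaryDigits]
    split_ifs with h
    · rw [toReal_bitsCoin_cons, pow_succ]
      -- Removing a leading digit keeps the number in `[0, 1]` and doubles the error.
      obtain ⟨h₁, h₂⟩ := ih (r := 2 * r - 1) (by linarith) (by linarith)
      constructor <;> simp only [cond_true] <;> linarith
    · rw [toReal_bitsCoin_cons, pow_succ]
      obtain ⟨h₁, h₂⟩ := ih (r := 2 * r) (by linarith) (by linarith)
      constructor <;> simp only [cond_false] <;> linarith

/-- Two biases in the ratio of almost `1` give combinations in the ratio of almost `1`. -/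
theorem convexComb_le_of_approx {p q b₁ b₂ η : ℝ} (hp : 0 < p) (hp1 : p < 1) (hb₁ : 0 ≤ b₁)
    (hb₂ : 0 ≤ b₂) (hη : η ≤ p / 2) (hqp : q ≤ p) (hpq : p - η ≤ q) :
    p * b₁ + (1 - p) * b₂ ≤ (1 + (2 / p + 1 / (1 - p)) * η) * (q * b₁ + (1 - q) * b₂) ∧
      q * b₁ + (1 - q) * b₂ ≤
        (1 + (2 / p + 1 / (1 - p)) * η) * (p * b₁ + (1 - p) * b₂) := by
  have hη0 : 0 ≤ η := by linarith
  have hp1' : 0 < 1 - p := by linarith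
  -- Since `η ≤ p / 2`, also `q ≥ p / 2`, so the absolute error `η` is at most `2 / p * η` relative
  -- to `q`.
  have e₁ : p ≤ (1 + 2 / p * η) * q := by
    have h₁ : 2 / p * η * (p / 2) = η := by field_simp
    have h₂ : 2 / p * η * (p / 2) ≤ 2 / p * η * q :=
      mul_le_mul_of_nonneg_left (by linarith) (by positivity)
    linarith
  have e₂ : 1 - q ≤ (1 + 1 / (1 - p) * η) * (1 - p) := by
    have h₁ : 1 / (1 - p) * η * (1 - p) = η := by field_simp
    linarith
  have f₁ : 0 ≤ 2 / p * η := by positivity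
  have f₂ : 0 ≤ 1 / (1 - p) * η := by positivity
  have hq : 0 ≤ q := by linarith
  constructor
  · have g₁ : p * b₁ ≤ (1 + 2 / p * η) * q * b₁ := mul_le_mul_of_nonneg_right e₁ hb₁
    have g₂ : (1 - p) * b₂ ≤ (1 - q) * b₂ := mul_le_mul_of_nonneg_right (by linarith) hb₂
    have g₃ : 0 ≤ 1 / (1 - p) * η * (q * b₁) := by positivity
    have g₄ : 0 ≤ (2 / p * η + 1 / (1 - p) * η) * ((1 - q) * b₂) :=
      mul_nonneg (by linarith) (mul_nonneg (by linarith) hb₂)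
    linarith
  · have g₁ : q * b₁ ≤ p * b₁ := mul_le_mul_of_nonneg_right hqp hb₁
    have g₂ : (1 - q) * b₂ ≤ (1 + 1 / (1 - p) * η) * (1 - p) * b₂ :=
      mul_le_mul_of_nonneg_right e₂ hb₂
    have g₃ : 0 ≤ 2 / p * η * ((1 - p) * b₂) := by positivity
    have g₄ : 0 ≤ (2 / p * η + 1 / (1 - p) * η) * (p * b₁) := by positivity
    linarith

/-! ### Convexity and post-processing -/

variable {ε : ℕ → ℝ}

theorem convexity_indCDP : SatisfiesConvexity (IndCDP (T := T) ε) := by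
  rintro M₁ M₂ ⟨n₁, hn₁, h₁⟩ ⟨n₂, hn₂, h₂⟩ p
  refine ⟨_, hn₁.mix hn₂ p, fun A hA P => ?_⟩
  filter_upwards [h₁ A hA P, h₂ A hA P] with κ h₁ h₂ D₁ D₂ hD₁ hD₂ hD
  rw [prOne_mix, prOne_mix]
  have e₁ := mul_le_mul_of_nonneg_left (h₁ D₁ D₂ hD₁ hD₂ hD) p.2.1
  have e₂ := mul_le_mul_of_nonneg_left (h₂ D₁ D₂ hD₁ hD₂ hD) (sub_nonneg.2 p.2.2)
  linarith

theorem postProcessing_indCDP : SatisfiesPPTPostProcessing (IndCDP (T := T) ε) := by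
  rintro M ⟨n, hn, h⟩ f hf
  refine ⟨n, hn, fun A hA P => ?_⟩
  filter_upwards [h _ (hf.comp hA) P] with κ h D₁ D₂ hD₁ hD₂ hD
  simpa only [postProcess, prOne_bind] using h D₁ D₂ hD₁ hD₂ hD

theorem convexity_simCDP : SatisfiesConvexity (SimCDP (T := T) ε) := by
  rintro M₁ M₂ ⟨M₁', hM₁', n₁, hn₁, h₁⟩ ⟨M₂', hM₂', n₂, hn₂, h₂⟩ p
  refine ⟨mix p M₁' M₂', fun κ D₁ D₂ hD => (hM₁' κ D₁ D₂ hD).coin_bind (hM₂' κ D₁ D₂ hD) _,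
    _, hn₁.mix hn₂ p, fun A hA P => ?_⟩
  filter_upwards [h₁ A hA P, h₂ A hA P] with κ h₁ h₂ D hD
  rw [prOne_mix, prOne_mix]
  have e₁ := mul_le_mul_of_nonneg_left (h₁ D hD) p.2.1
  have e₂ := mul_le_mul_of_nonneg_left (h₂ D hD) (sub_nonneg.2 p.2.2)
  linarith

theorem postProcessing_simCDP : SatisfiesPPTPostProcessing (SimCDP (T := T) ε) := by
  rintro M ⟨M', hM', n, hn, h⟩ f hf
  refine ⟨postProcess f M', fun κ D₁ D₂ hD => (hM' κ D₁ D₂ hD).bind _, n, hn,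
    fun A hA P => ?_⟩
  filter_upwards [h _ (hf.comp hA) P] with κ h D hD
  simpa only [postProcess, prOne_bind] using h D hD

theorem postProcessing_czkPrivate (Agg : Set (Mech T)) :
    SatisfiesPPTPostProcessing (CZKPrivate Agg ε) := by
  rintro M ⟨agg, hagg, Sim, hSim, n, hn, h⟩ f hf
  refine ⟨agg, hagg, _, hSim.comp hf, n, hn, fun A hA P => ?_⟩
  filter_upwards [h _ (hf.comp hA) P] with κ h D₁ D₂ hD₁ hD₂ hD
  simpa only [postProcess, prOne_bind, PMF.bind_bind] using h D₁ D₂ hD₁ hD₂ hD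

/-- The endpoints are treated separately because the relative error bound divides by `p` and `1 -
p`. -/
theorem mix_zero (M₁ M₂ : Mech T) : mix 0 M₁ M₂ = M₂ := by
  funext κ D
  have h : biasedCoin 0 = PMF.pure false := by
    ext b; cases b <;> simp [biasedCoin]
  rw [mix, h, PMF.pure_bind, cond_false]

theorem mix_one (M₁ M₂ : Mech T) : mix 1 M₁ M₂ = M₁ := by
  funext κ D
  have h : biasedCoin 1 = PMF.pure true := by
    ext b; cases b <;> simp [biasedCoin]
  rw [mix, h, PMF.pure_bind, cond_true]

/-- For probabilities, a factor close to `1` can be replaced by an additive error, regardless of the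
size of `e`. -/
theorem le_mul_add_of_le_mul_one_add {a b b' e n δ : ℝ} (ha : a ≤ 1) (he : 0 ≤ e) (hδ : 0 ≤ δ)
    (h : a ≤ e * b' + n) (hb : b' ≤ (1 + δ) * b) : a ≤ e * b + (|n| + δ) := by
  -- If `e * b ≥ 1`, then `a ≤ 1` suffices; otherwise the surplus `e * b * δ` is at most `δ`.
  rcases le_total 1 (e * b) with h1 | h1
  · linarith [abs_nonneg n]
  · have h₁ := mul_le_mul_of_nonneg_left hb he
    have h₂ := mul_le_mul_of_nonneg_left h1 hδ
    linarith [le_abs_self n]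

theorem convexity_czkPrivate {Agg : Set (Mech T)} (hAgg : AggDirected Agg) :
    SatisfiesConvexity (CZKPrivate Agg ε) := by
  intro M₁ M₂ hM₁ hM₂ p
  rcases eq_or_ne p 0 with rfl | hp0
  · rwa [mix_zero]
  rcases eq_or_ne p 1 with rfl | hp1
  · rwa [mix_one]
  replace hp0 : 0 < (p : ℝ) := unitInterval.pos_iff_ne_zero.2 hp0
  replace hp1 : (p : ℝ) < 1 := unitInterval.lt_one_iff_ne_one.2 hp1
  obtain ⟨a₁, ha₁, S₁, hS₁, n₁, hn₁, h₁⟩ := hM₁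
  obtain ⟨a₂, ha₂, S₂, hS₂, n₂, hn₂, h₂⟩ := hM₂
  obtain ⟨a, ha, g₁, g₂, hg₁, hg₂, hg⟩ := hAgg a₁ ha₁ a₂ ha₂
  set C : ℝ := 2 / p + 1 / (1 - p)
  have hC : 0 ≤ C := by
    have : 0 < 1 - (p : ℝ) := by linarith
    positivity
  refine ⟨a, ha, _, (hg₁.comp hS₁).bitsCoin_bind (hg₂.comp hS₂) (fun κ => binaryDigits κ p)
    (fun κ => length_binaryDigits κ p), _,
    (hn₁.mix hn₂ p).abs.add (negligible_const_mul_two_pow C), fun A hA P => ?_⟩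
  have hsmall : ∀ᶠ κ : ℕ in Filter.atTop, (1 / 2 : ℝ) ^ κ ≤ p / 2 :=
    (tendsto_pow_atTop_nhds_zero_of_lt_one (by norm_num) (by norm_num)).eventually_le_const
      (by linarith)
  filter_upwards [h₁ A hA P, h₂ A hA P, hsmall] with κ h₁ h₂ hη D₁ D₂ hD₁ hD₂ hD
  obtain ⟨h₁, h₁'⟩ := h₁ D₁ D₂ hD₁ hD₂ hD
  obtain ⟨h₂, h₂'⟩ := h₂ D₁ D₂ hD₁ hD₂ hD
  -- The coin is independent of the aggregate, so it may be tossed first; each branch then recovers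
  -- its own aggregate.
  have hsim : ((a κ D₂).bind fun x => (bitsCoin (binaryDigits κ p)).bind fun b =>
      cond b ((g₁ κ x).bind (S₁ κ)) ((g₂ κ x).bind (S₂ κ))) =
      (bitsCoin (binaryDigits κ p)).bind fun b =>
        cond b ((a₁ κ D₂).bind (S₁ κ)) ((a₂ κ D₂).bind (S₂ κ)) := by
    rw [PMF.bind_comm]
    congr 1
    funext b
    cases b
    · simp only [cond_false]; rw [← PMF.bind_bind, (hg κ D₂).2]
    · simp only [cond_true]; rw [← PMF.bind_bind, (hg κ D₂).1]
  rw [hsim, prOne_mix, prOne_coin_bind]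
  obtain ⟨hq, hq'⟩ := bitsCoin_binaryDigits κ p.2.1 p.2.2
  have ha₁ := prOne_le_one (A κ) (M₁ κ D₁)
  have ha₂ := prOne_le_one (A κ) (M₂ κ D₁)
  have hb₁ := prOne_le_one (A κ) ((a₁ κ D₂).bind (S₁ κ))
  have hb₂ := prOne_le_one (A κ) ((a₂ κ D₂).bind (S₂ κ))
  obtain ⟨hc, hc'⟩ := convexComb_le_of_approx hp0 hp1
    (prOne_nonneg (A κ) ((a₁ κ D₂).bind (S₁ κ))) (prOne_nonneg (A κ) ((a₂ κ D₂).bind (S₂ κ)))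
    hη hq hq'
  have hδ : 0 ≤ C * (1 / 2) ^ κ := by positivity
  have comb : ∀ {x₁ x₂ y₁ y₂ : ℝ}, x₁ ≤ Real.exp (ε κ) * y₁ + n₁ κ →
      x₂ ≤ Real.exp (ε κ) * y₂ + n₂ κ → p * x₁ + (1 - p) * x₂ ≤
        Real.exp (ε κ) * (p * y₁ + (1 - p) * y₂) + (p * n₁ κ + (1 - p) * n₂ κ) := by
    intro x₁ x₂ y₁ y₂ e₁ e₂
    have e₁ := mul_le_mul_of_nonneg_left e₁ p.2.1
    have e₂ := mul_le_mul_of_nonneg_left e₂ (sub_nonneg.2 p.2.2)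
    linarith
  have comb_le_one : ∀ {x₁ x₂ : ℝ}, x₁ ≤ 1 → x₂ ≤ 1 → p * x₁ + (1 - p) * x₂ ≤ 1 := by
    intro x₁ x₂ e₁ e₂
    have e₁ := mul_le_mul_of_nonneg_left e₁ p.2.1
    have e₂ := mul_le_mul_of_nonneg_left e₂ (sub_nonneg.2 p.2.2)
    linarith
  refine ⟨le_mul_add_of_le_mul_one_add (comb_le_one ha₁ ha₂) (Real.exp_pos _).le hδ
    (comb h₁ h₂) hc, ?_⟩
  -- In this direction the factor sits on the smaller side, without `e^ε`, and costs at most `δ`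
  -- directly.
  have h₃ := mul_le_mul_of_nonneg_left (comb_le_one hb₁ hb₂) hδ
  have h₄ := comb h₁' h₂'
  have h₅ := le_abs_self (p * n₁ κ + (1 - p) * n₂ κ)
  simp only [Pi.add_apply]
  linarith

end

end CompDP

theorem mainTheorem7 {T : Type*} (ε : ℕ → ℝ) :
    (CompDP.SatisfiesConvexity (CompDP.IndCDP (T := T) ε) ∧
      CompDP.SatisfiesPPTPostProcessing (CompDP.IndCDP (T := T) ε)) ∧
    (CompDP.SatisfiesConvexity (CompDP.SimCDP (T := T) ε) ∧
      CompDP.SatisfiesPPTPostProcessing (CompDP.SimCDP (T := T) ε)) ∧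
    (∀ Agg : Set (CompDP.Mech T),
      (CompDP.AggDirected Agg → CompDP.SatisfiesConvexity (CompDP.CZKPrivate Agg ε)) ∧
      CompDP.SatisfiesPPTPostProcessing (CompDP.CZKPrivate Agg ε)) :=
  ⟨⟨CompDP.convexity_indCDP, CompDP.postProcessing_indCDP⟩,
    ⟨CompDP.convexity_simCDP, CompDP.postProcessing_simCDP⟩,
    fun Agg => ⟨CompDP.convexity_czkPrivate, CompDP.postProcessing_czkPrivate Agg⟩⟩
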